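/- Let $A$ be a unital $C^*$-algebra, let $\rho$ be a pure state of $A$ (an extreme point of the set of states), and let $R\subseteq A$ be a family of mutually commuting self-adjoint elements. Write $R'$ for the commutant of $R$, and say that a unitary $U\in A$ fixes $\rho$ if $\rho(U^*aU)=\rho(a)$ for all $a\in A$. A dispersion-free state of a unital $C^*$-subalgebra $B\subseteq A$ is a state $\omega$ of $B$ with $\omega(XY)=\omega(X)\omega(Y)$ for all $X,Y\in B$. The algebra $B$ is *beable for* $\rho$ if $\rho|_B$ is a mixture of dispersion-free states, i.e. there is a Borel probability measure $\mu$ on the space $\mathcal S$ of dispersion-free states of $B$ (with the weak-$*$ topology) such that $\rho(b)=\int_{\mathcal S}\omega(b)\,d\mu(\omega)$ for all $b\in B$. It is *$R$-beable for* $\rho$ if it is beable for $\rho$, $R\subseteq B$, and $UBU^*=B$ for every unitary $U\in A$ with $U\in R'$ that fixes $\rho$. Let $(\pi_\rho,H_\rho,x_\rho)$ be the GNS representation of $A$ induced by $\rho$, let $\mathrm{VN}(\pi_\rho(R))=\pi_\rho(R)''$ be the von Neumann algebra generated by $\pi_\rho(R)$, let $S\subseteq H_\rho$ be the closed linear span of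 $\pi_\rho(R)''x_\rho$ with orthogonal projection $P_S$, and put $$B(\pi_\rho(R),x_\rho)=L(S^\perp)\oplus \mathrm{VN}(\pi_\rho(R))P_S\subseteq L(H_\rho),\qquad B(R,\rho)=\pi_\rho^{-1}\bigl[B(\pi_\rho(R),x_\rho)\bigr].$$ Then $B(R,\rho)$ is a unital $C^*$-subalgebra of $A$ which is $R$-beable for $\rho$. Moreover, every unitary $U\in A$ with $U\in R'$ that fixes $\rho$ belongs to $B(R,\rho)$. -/

import Mathlib

open scoped ComplexOrder

namespace BeableAlgebra

open MeasureTheory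

/-! ### States and dispersion-free states -/

section States

variable {B : Type*} [Ring B] [StarRing B] [Algebra ℂ B]

/-- A state of a unital C⋆-algebra: a positive linear functional normalised by `φ 1 = 1`
(equivalently, of norm one). The positive elements of a C⋆-algebra are the `star b * b`. -/
structure IsState (φ : B →ₗ[ℂ] ℂ) : Prop where
  map_one : φ 1 = 1
  nonneg : ∀ b : B, 0 ≤ φ (star b * b)

/-- A pure state: an extreme point of the convex set of all states. -/
def IsPureState (φ : B →ₗ[ℂ] ℂ) : Prop :=
  φ ∈ Set.extremePoints ℝ {ψ : B →ₗ[ℂ] ℂ | IsState ψ}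

/-- The definite algebra of `ω`: the elements on which `ω` is dispersion-free. -/
def definiteAlgebra (ω : B →ₗ[ℂ] ℂ) : Set B :=
  {X | ∀ Y : B, ω (X * Y) = ω X * ω Y}

end States

variable {A : Type*} [CStarAlgebra A]

/-- The space of dispersion-free states of the subalgebra `B`, with the weak-⋆ topology. -/
abbrev DispersionFreeState (B : StarSubalgebra ℂ A) : Type _ :=
  {ω : WeakDual ℂ B //
    IsState (ω : B →L[ℂ] ℂ).toLinearMap ∧
      ∀ X : B, X ∈ definiteAlgebra (ω : B →L[ℂ] ℂ).toLinearMap}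

/-- The Borel σ-algebra of the weak-⋆ topology. -/
noncomputable instance (B : StarSubalgebra ℂ A) : MeasurableSpace (DispersionFreeState B) :=
  borel _

instance (B : StarSubalgebra ℂ A) : BorelSpace (DispersionFreeState B) := ⟨rfl⟩

section Beable

variable [PartialOrder A]

/-- `B` is beable for `ρ`: the restriction of `ρ` to `B` is a mixture of dispersion-free states
of `B`. -/
def IsBeable (B : StarSubalgebra ℂ A) (ρ : A →ₚ[ℂ] ℂ) : Prop :=
  ∃ μ : Measure (DispersionFreeState B), IsProbabilityMeasure μ ∧
    ∀ b : B, Integrable (fun ω : DispersionFreeState B => ω.1 b) μ ∧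
      ρ (b : A) = ∫ ω : DispersionFreeState B, ω.1 b ∂μ

/-- `U` fixes `ρ`, that is, `ρ (U⋆ a U) = ρ a` for all `a`. -/
def Fixes (U : A) (ρ : A →ₚ[ℂ] ℂ) : Prop :=
  ∀ a : A, ρ (star U * a * U) = ρ a

/-- `B` is a C⋆-subalgebra that is `R`-beable for `ρ`. -/
structure IsRBeable (R : Set A) (B : StarSubalgebra ℂ A) (ρ : A →ₚ[ℂ] ℂ) : Prop where
  isClosed : IsClosed (B : Set A)
  beable : IsBeable B ρ
  priv : R ⊆ B
  definable : ∀ U ∈ unitary A, U ∈ Set.centralizer R → Fixes U ρ →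
    (fun b => U * b * star U) '' (B : Set A) = B

end Beable

/-! ### The algebra determined by a family of operators and a vector -/

section Concrete

variable {H : Type*} [NormedAddCommGroup H] [InnerProductSpace ℂ H] [CompleteSpace H]

/-- The von Neumann algebra generated by `R`, i.e. the double commutant of `R ∪ star R`
(which is the double commutant `R''` when `R` consists of self-adjoint operators). -/
noncomputable def vonNeumannGenerated (R : Set (H →L[ℂ] H)) : VonNeumannAlgebra H where
  toStarSubalgebra := StarSubalgebra.centralizer ℂ
    (StarSubalgebra.centralizer ℂ R : Set (H →L[ℂ] H))
  centralizer_centralizer' := by simp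

/-- The closed linear span `[R'' v]` of the vectors `V v`, for `V` in the von Neumann algebra
generated by `R`. -/
noncomputable def cyclicSubspace (R : Set (H →L[ℂ] H)) (v : H) : Submodule ℂ H :=
  (Submodule.span ℂ {y | ∃ V ∈ vonNeumannGenerated R, V v = y}).topologicalClosure

instance (R : Set (H →L[ℂ] H)) (v : H) : CompleteSpace (cyclicSubspace R v) :=
  (Submodule.isClosed_topologicalClosure _).completeSpace_coe

/-- The orthogonal projection of `H` onto `[R'' v]`. -/
noncomputable def cyclicProj (R : Set (H →L[ℂ] H)) (v : H) : H →L[ℂ] H :=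
  (cyclicSubspace R v).starProjection

theorem map_mem_cyclicSubspace {R : Set (H →L[ℂ] H)} {v : H} {V : H →L[ℂ] H}
    (hV : V ∈ vonNeumannGenerated R) {y : H} (hy : y ∈ cyclicSubspace R v) :
    V y ∈ cyclicSubspace R v := by
  refine map_mem_closure V.continuous hy fun z hz => ?_
  refine Submodule.span_induction (p := fun z _ => V z ∈
    Submodule.span ℂ {y | ∃ V ∈ vonNeumannGenerated R, V v = y}) ?_ ?_ ?_ ?_ hz
  · rintro _ ⟨W, hW, rfl⟩
    exact Submodule.subset_span ⟨V * W, mul_mem hV hW, rfl⟩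
  · simp
  · intro x y _ _ hx hy
    rw [map_add]
    exact add_mem hx hy
  · intro c x _ hx
    rw [map_smul]
    exact Submodule.smul_mem _ c hx

theorem isStarProjection_cyclicProj (R : Set (H →L[ℂ] H)) (v : H) :
    IsStarProjection (cyclicProj R v) :=
  isStarProjection_starProjection

theorem cyclicProj_comm {R : Set (H →L[ℂ] H)} {v : H} {V : H →L[ℂ] H}
    (hV : V ∈ vonNeumannGenerated R) : V * cyclicProj R v = cyclicProj R v * V := by
  refine VonNeumannAlgebra.mem_commutant_iff.1 ?_ V hV
  rw [VonNeumannAlgebra.IsStarProjection.mem_iff (isStarProjection_cyclicProj R v)]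
  intro W hW
  rw [VonNeumannAlgebra.commutant_commutant] at hW
  have hr : (cyclicProj R v).range = cyclicSubspace R v := by
    simp [cyclicProj]
  rw [hr, Module.End.mem_invtSubmodule]
  exact fun y hy => map_mem_cyclicSubspace hW hy

/-- With `S = [R'' v]` and `P` the projection onto `S`, this is the algebra
`L(Sᗮ) ⊕ R'' P` of operators on `H`. -/
noncomputable def concreteBeable (R : Set (H →L[ℂ] H)) (v : H) :
    StarSubalgebra ℂ (H →L[ℂ] H) where
  carrier := {T | ∃ X : H →L[ℂ] H, ∃ V ∈ vonNeumannGenerated R,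
    T = (1 - cyclicProj R v) * X * (1 - cyclicProj R v) + V * cyclicProj R v}
  mul_mem' := by
    rintro _ _ ⟨X, V, hV, rfl⟩ ⟨Y, W, hW, rfl⟩
    refine ⟨X * (1 - cyclicProj R v) * Y, V * W, mul_mem hV hW, ?_⟩
    have hP := (isStarProjection_cyclicProj R v).isIdempotentElem.eq
    have hc := cyclicProj_comm (v := v) hW
    generalize cyclicProj R v = P at hP hc ⊢
    have h1 : P * (1 - P) = 0 := by rw [mul_sub, mul_one, hP, sub_self]
    have h2 : (1 - P) * P = 0 := by rw [sub_mul, one_mul, hP, sub_self]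
    have h3 : (1 - P) * (1 - P) = 1 - P := by rw [mul_sub, h2, mul_one, sub_zero]
    calc ((1 - P) * X * (1 - P) + V * P) * ((1 - P) * Y * (1 - P) + W * P)
        = (1 - P) * X * ((1 - P) * (1 - P)) * Y * (1 - P) + (1 - P) * X * ((1 - P) * (W * P))
          + V * (P * (1 - P)) * Y * (1 - P) + V * (P * W) * P := by noncomm_ring
      _ = _ := by
        have h4 : (1 - P) * (W * P) = 0 := by rw [hc, ← mul_assoc, h2, zero_mul]
        rw [h1, h3, h4, ← hc, mul_zero, mul_zero, zero_mul, zero_mul, add_zero, add_zero,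
          mul_assoc V, mul_assoc W, hP]
        simp only [mul_assoc]
  add_mem' := by
    rintro _ _ ⟨X, V, hV, rfl⟩ ⟨Y, W, hW, rfl⟩
    exact ⟨X + Y, V + W, add_mem hV hW, by noncomm_ring⟩
  algebraMap_mem' c := by
    refine ⟨algebraMap ℂ _ c, algebraMap ℂ _ c,
      (vonNeumannGenerated R).toStarSubalgebra.algebraMap_mem c, ?_⟩
    have hP := (isStarProjection_cyclicProj R v).isIdempotentElem.eq
    rw [← Algebra.commutes, mul_assoc, ← mul_add]
    rw [(isStarProjection_cyclicProj R v).isIdempotentElem.one_sub.eq, sub_add_cancel, mul_one]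
  star_mem' := by
    rintro _ ⟨X, V, hV, rfl⟩
    refine ⟨star X, star V, star_mem hV, ?_⟩
    have hs := (isStarProjection_cyclicProj R v).isSelfAdjoint.star_eq
    rw [cyclicProj_comm hV]
    simp only [star_add, star_mul, star_sub, star_one, hs, mul_assoc]

end Concrete

/-! ### The algebra determined by a family of observables and a state -/

section GNS

variable [PartialOrder A] [StarOrderedRing A]

/-- The canonical cyclic vector of the GNS representation of `ρ`: the class of `1`. -/
noncomputable def gnsVector (ρ : A →ₚ[ℂ] ℂ) : ρ.GNS :=
  ((ρ.toPreGNS 1 : ρ.PreGNS) : ρ.GNS)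

/-- The inverse image, under the GNS representation `π` of `ρ` with cyclic vector `x`, of the
algebra determined by `π(R)` and `x`. -/
noncomputable def beableAlgebra (R : Set A) (ρ : A →ₚ[ℂ] ℂ) : StarSubalgebra ℂ A :=
  (concreteBeable (ρ.gnsStarAlgHom '' R) (gnsVector ρ)).comap ρ.gnsStarAlgHom

end GNS

end BeableAlgebra

/-! Let `x` be the GNS vector, `M = π(R)''`, `P` the projection onto `S = [M x]`, and suppose the
unitary `U ∈ R'` fixes `ρ`. For `|c| = 1` the functionals `ρ((1 ± cU)⋆ · (1 ± cU))` are positive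
with sum `4ρ`, so by purity each is a multiple of `ρ`. Taking `c = 1, i` gives `ρ(aU) = ρ(a)ρ(U)`,
which makes `x` an eigenvector of `π(U)`. Since `π(U)` commutes with `M`, it is scalar on `S`; so is
its adjoint, hence `π(U)` commutes with `P`, and `U` lies in `B(R,ρ)`. Invariance under conjugation
by `U` is then automatic.

Beability holds because elements of `B(R,ρ)` act on `S` as elements of the abelian algebra `M`.
Restriction to `S` therefore has commutative range, and `ρ` is a vector state there; Gelfand duality
and Riesz representation write it as an integral of characters, which pull back to dispersion-free
states (`isBeable_of_starAlgHom`).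

Norm closedness reduces to that of `M P` (`isClosed_reduced`), which is an isometric image of `M Z`
for `Z` the support of `x` in `M`. -/

namespace BeableAlgebra

/-! ### Pure states and elements fixing them -/

section PureStates

variable {B : Type*} [Ring B] [StarRing B] [Algebra ℂ B]

/-- A positive functional dominated by a multiple of a pure state is a multiple of it. -/
theorem IsPureState.eq_smul_of_add_eq {φ : B →ₗ[ℂ] ℂ} (hφ : IsPureState φ)
    {ψ₁ ψ₂ : B →ₗ[ℂ] ℂ} (h₁ : ∀ b, 0 ≤ ψ₁ (star b * b)) (h₂ : ∀ b, 0 ≤ ψ₂ (star b * b))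
    {c : ℂ} (h : ψ₁ + ψ₂ = c • φ) : ψ₁ = ψ₁ 1 • φ := by
  obtain ⟨hs, hext⟩ := hφ
  -- Adding `φ` before normalising avoids dividing by `ψ 1`, which may vanish.
  have key : ∀ ψ : B →ₗ[ℂ] ℂ, (∀ b, 0 ≤ ψ (star b * b)) → ∃ p : ℝ, 0 ≤ p ∧ ψ 1 = p ∧
      IsState ((((p + 1 : ℝ) : ℂ)⁻¹) • (ψ + φ)) := by
    intro ψ hψ
    have h1 := hψ 1
    rw [star_one, one_mul] at h1
    have hp1 : ψ 1 = ((ψ 1).re : ℂ) := by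
      apply Complex.ext <;> simp [(Complex.nonneg_iff.1 h1).2.symm]
    refine ⟨(ψ 1).re, (Complex.nonneg_iff.1 h1).1, hp1, ?_, ?_⟩
    · have : (((ψ 1).re + 1 : ℝ) : ℂ) ≠ 0 := by
        have := (Complex.nonneg_iff.1 h1).1
        exact_mod_cast (by linarith : (ψ 1).re + 1 ≠ 0)
      rw [LinearMap.smul_apply, LinearMap.add_apply, hs.map_one, smul_eq_mul]
      nth_rewrite 2 [hp1]
      push_cast at this ⊢
      exact inv_mul_cancel₀ this
    · intro b
      rw [LinearMap.smul_apply, smul_eq_mul]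
      refine mul_nonneg ?_ (add_nonneg (hψ b) (hs.nonneg b))
      rw [← Complex.ofReal_inv]
      exact Complex.zero_le_real.2 (inv_nonneg.2 (by
        have := (Complex.nonneg_iff.1 h1).1
        linarith))
  obtain ⟨p, hp, hp1, hsp⟩ := key ψ₁ h₁
  obtain ⟨q, hq, hq1, hsq⟩ := key ψ₂ h₂
  have hc : (p : ℂ) + q = c := by
    have := LinearMap.congr_fun h 1
    simpa [hp1, hq1, hs.map_one] using this
  have hp0 : ((p : ℂ) + 1) ≠ 0 := by exact_mod_cast (by linarith : p + 1 ≠ 0)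
  have hq0 : ((q : ℂ) + 1) ≠ 0 := by exact_mod_cast (by linarith : q + 1 ≠ 0)
  have hpq : ((p : ℂ) + q + 2) ≠ 0 := by exact_mod_cast (by linarith : p + q + 2 ≠ 0)
  have hmem : φ ∈ openSegment ℝ ((((p + 1 : ℝ) : ℂ)⁻¹) • (ψ₁ + φ))
      ((((q + 1 : ℝ) : ℂ)⁻¹) • (ψ₂ + φ)) := by
    -- These weights cancel the normalisations, leaving `(ψ₁ + ψ₂ + 2φ) / (p + q + 2)`, where `ψ₁ +
    -- ψ₂ = (p + q)φ`.
    refine ⟨(p + 1) / (p + q + 2), (q + 1) / (p + q + 2), by positivity, by positivity,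
      by field_simp; ring, ?_⟩
    ext a
    have ha := LinearMap.congr_fun h a
    simp only [LinearMap.add_apply, LinearMap.smul_apply, smul_eq_mul, Complex.real_smul] at ha ⊢
    have e : ψ₂ a = c * φ a - ψ₁ a := by rw [← ha]; ring
    rw [e, ← hc]
    push_cast
    field_simp
    ring
  have := hext hsp hsq hmem
  ext a
  have ha := LinearMap.congr_fun this a
  simp only [LinearMap.add_apply, LinearMap.smul_apply, smul_eq_mul] at ha ⊢
  push_cast at ha
  rw [inv_mul_eq_iff_eq_mul₀ hp0] at ha
  rw [hp1]
  linear_combination ha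

/-- The functional `a ↦ φ (z⋆ a z)`. -/
def conjFunctional (φ : B →ₗ[ℂ] ℂ) (z : B) : B →ₗ[ℂ] ℂ :=
  φ ∘ₗ LinearMap.mulRight ℂ z ∘ₗ LinearMap.mulLeft ℂ (star z)

theorem conjFunctional_apply (φ : B →ₗ[ℂ] ℂ) (z a : B) :
    conjFunctional φ z a = φ (star z * a * z) := rfl

theorem conjFunctional_nonneg {φ : B →ₗ[ℂ] ℂ} (hφ : IsState φ) (z b : B) :
    0 ≤ conjFunctional φ z (star b * b) := by
  rw [conjFunctional_apply]
  simpa [mul_assoc] using hφ.nonneg (b * z)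

/-- An isometry fixing a pure state is dispersion-free in it. -/
theorem IsPureState.map_mul_of_fixes [StarModule ℂ B] {φ : B →ₗ[ℂ] ℂ} (hφ : IsPureState φ) {U : B}
    (hU : ∀ a, φ (star U * a * U) = φ a) (a : B) : φ (a * U) = φ a * φ U := by
  have key : ∀ c : ℂ, star c * c = 1 →
      c * φ (a * U) + star c * φ (star U * a) = (c * φ U + star c * φ (star U)) * φ a := by
    intro c hc
    have hexp : ∀ (d : ℂ) (b : B), star d * d = 1 →
        conjFunctional φ (1 + d • U) b =
          2 * φ b + d * φ (b * U) + star d * φ (star U * b) := by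
      intro d b hd
      have : star (1 + d • U) * b * (1 + d • U) =
          b + d • (b * U) + star d • (star U * b) + (star d * d) • (star U * b * U) := by
        simp only [star_add, star_one, star_smul, add_mul, mul_add, one_mul, mul_one,
          smul_mul_assoc, mul_smul_comm, smul_smul, smul_add]
        rw [mul_comm d]
        abel
      rw [conjFunctional_apply, this, hd]
      simp only [map_add, map_smul, smul_eq_mul, hU, one_mul]
      ring
    have hcn : star (-c) * (-c) = 1 := by simpa using hc
    have hsum : conjFunctional φ (1 + c • U) + conjFunctional φ (1 + (-c) • U) = (4 : ℂ) • φ := by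
      ext b
      rw [LinearMap.add_apply, hexp c b hc, hexp (-c) b hcn, LinearMap.smul_apply, smul_eq_mul,
        star_neg]
      ring
    have h := LinearMap.congr_fun (hφ.eq_smul_of_add_eq (conjFunctional_nonneg hφ.1 _)
      (conjFunctional_nonneg hφ.1 _) hsum) a
    rw [LinearMap.smul_apply, hexp c a hc, hexp c 1 hc, hφ.1.map_one, smul_eq_mul] at h
    simp only [one_mul, mul_one] at h
    linear_combination h
  -- The values `c = 1` and `c = i` give the sum and the difference of the two cross terms, which
  -- isolates `φ (a * U)`.
  have h1 := key 1 (by simp)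
  have h2 := key Complex.I (by simp)
  simp only [star_one, one_mul, Complex.star_def, Complex.conj_I] at h1 h2
  linear_combination (1 / 2 : ℂ) * h1 - (Complex.I / 2) * h2 +
    (φ (a * U) - φ (star U * a) - φ U * φ a + φ (star U) * φ a) * (1 / 2) * Complex.I_sq

/-- A state maps self-adjoint elements to real numbers. -/
theorem IsState.im_eq_zero {φ : B →ₗ[ℂ] ℂ} (hφ : IsState φ) {b : B} (hb : IsSelfAdjoint b) :
    (φ b).im = 0 := by
  -- Polarisation: `2b = (b + 1)² - b² - 1`.
  have h1 := (Complex.nonneg_iff.1 (hφ.nonneg (b + 1))).2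
  have h2 := (Complex.nonneg_iff.1 (hφ.nonneg b)).2
  simp only [star_add, hb.star_eq, star_one, add_mul, mul_add, one_mul, mul_one, map_add,
    hφ.map_one, Complex.add_im, Complex.one_im] at h1 h2
  linarith

theorem IsState.apply_star [StarModule ℂ B] {φ : B →ₗ[ℂ] ℂ} (hφ : IsState φ) (b : B) :
    φ (star b) = star (φ b) := by
  have h1 := hφ.im_eq_zero (IsSelfAdjoint.add_star_self b)
  have h2 : (φ (Complex.I • b + star (Complex.I • b))).im = 0 :=
    hφ.im_eq_zero (IsSelfAdjoint.add_star_self _)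
  simp only [star_smul, map_add, map_smul, smul_eq_mul, Complex.star_def, Complex.conj_I,
    Complex.add_im, Complex.mul_im, Complex.I_re, Complex.I_im, Complex.neg_re,
    Complex.neg_im] at h1 h2
  apply Complex.ext <;> simp only [Complex.star_def, Complex.conj_re, Complex.conj_im] <;> linarith

end PureStates

/-! ### Eigenvectors in the GNS representation -/

section GNS

variable {A : Type*} [CStarAlgebra A] [PartialOrder A] [StarOrderedRing A]

theorem gnsStarAlgHom_gnsVector (ρ : A →ₚ[ℂ] ℂ) (a : A) :
    ρ.gnsStarAlgHom a (gnsVector ρ) = ((ρ.toPreGNS a : ρ.PreGNS) : ρ.GNS) := by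
  change ρ.gnsNonUnitalStarAlgHom a _ = _
  rw [gnsVector, PositiveLinearMap.gnsNonUnitalStarAlgHom_apply_coe,
    PositiveLinearMap.leftMulMapPreGNS_apply]
  simp

/-- The cyclic vector of a pure state is an eigenvector of every unitary fixing the state. -/
theorem gnsStarAlgHom_apply_gnsVector (ρ : A →ₚ[ℂ] ℂ) (hρ : IsPureState ρ.toLinearMap) {U : A}
    (hU : U ∈ unitary A) (hfix : Fixes U ρ) :
    ρ.gnsStarAlgHom U (gnsVector ρ) = ρ U • gnsVector ρ := by
  have hmul : ∀ a, ρ (a * U) = ρ a * ρ U := fun a => hρ.map_mul_of_fixes hfix a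
  have hone : ρ 1 = 1 := hρ.1.map_one
  have hstar : ∀ a, ρ (star a) = star (ρ a) := fun a => hρ.1.apply_star a
  have h1 : ρ (star U) * ρ U = 1 := by
    rw [← hmul, Unitary.star_mul_self_of_mem hU, hone]
  -- The squared norm is the variance of `U` in `ρ`, which vanishes because `ρ (star U * U)`
  -- factors.
  have h0 : ‖ρ.toPreGNS (U - ρ U • 1)‖ = 0 := by
    rw [← sq_eq_zero_iff, ← Complex.ofReal_eq_zero, Complex.ofReal_pow,
      PositiveLinearMap.preGNS_norm_sq, PositiveLinearMap.ofPreGNS_toPreGNS]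
    have : star (U - ρ U • 1) * (U - ρ U • 1) =
        star U * U - ρ U • star U - star (ρ U) • U + (star (ρ U) * ρ U) • 1 := by
      simp only [star_sub, star_smul, star_one, sub_mul, mul_sub, smul_mul_assoc, mul_smul_comm,
        one_mul, mul_one, smul_smul, smul_sub]
      rw [mul_comm (star (ρ U))]
      abel
    rw [this, map_add, map_sub, map_sub, hmul, map_smul, map_smul, map_smul, hone, ← hstar]
    simp only [smul_eq_mul]
    ring
  have h2 : ρ.gnsStarAlgHom U (gnsVector ρ) - ρ U • gnsVector ρ =
      ((ρ.toPreGNS (U - ρ U • 1) : ρ.PreGNS) : ρ.GNS) := by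
    rw [gnsStarAlgHom_gnsVector, gnsVector, map_sub, map_smul, UniformSpace.Completion.coe_sub,
      UniformSpace.Completion.coe_smul]
  rw [← sub_eq_zero, ← norm_eq_zero, h2, UniformSpace.Completion.norm_coe, h0]

theorem inner_gnsVector (ρ : A →ₚ[ℂ] ℂ) (a : A) :
    inner ℂ (gnsVector ρ) (ρ.gnsStarAlgHom a (gnsVector ρ)) = ρ a := by
  rw [gnsStarAlgHom_gnsVector, gnsVector, UniformSpace.Completion.inner_coe,
    PositiveLinearMap.preGNS_inner_def]
  simp

end GNS


/-! ### The algebra `L(Sᗮ) ⊕ R'' P` and its norm closedness -/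

section Concrete

variable {H : Type*} [NormedAddCommGroup H] [InnerProductSpace ℂ H] [CompleteSpace H]

theorem subset_vonNeumannGenerated (R : Set (H →L[ℂ] H)) : R ⊆ vonNeumannGenerated R := by
  intro r hr
  change r ∈ StarSubalgebra.centralizer ℂ (StarSubalgebra.centralizer ℂ R : Set (H →L[ℂ] H))
  rw [StarSubalgebra.mem_centralizer_iff]
  intro g hg
  have hr' := fun (g : H →L[ℂ] H) (hg : g ∈ StarSubalgebra.centralizer ℂ R) => ((StarSubalgebra.mem_centralizer_iff ℂ).1 hg r hr).1
  exact ⟨(hr' g hg).symm, (hr' _ (star_mem hg)).symm⟩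

theorem commute_of_mem_vonNeumannGenerated {R : Set (H →L[ℂ] H)} {T V : H →L[ℂ] H}
    (hT : T ∈ StarSubalgebra.centralizer ℂ R) (hV : V ∈ vonNeumannGenerated R) : Commute T V :=
  ((StarSubalgebra.mem_centralizer_iff ℂ).1 hV T hT).1

/-- The von Neumann algebra generated by commuting self-adjoint operators is commutative. -/
theorem vonNeumannGenerated_commute {R : Set (H →L[ℂ] H)} (hsa : ∀ a ∈ R, IsSelfAdjoint a)
    (hcomm : ∀ a ∈ R, ∀ b ∈ R, Commute a b) {V W : H →L[ℂ] H} (hV : V ∈ vonNeumannGenerated R)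
    (hW : W ∈ vonNeumannGenerated R) : Commute V W := by
  -- Two passes: `R ⊆ R'` makes `V` commute with `R`, so `V ∈ R'`, and `W ∈ R''` then commutes with
  -- `V`.
  refine commute_of_mem_vonNeumannGenerated ?_ hW
  rw [StarSubalgebra.mem_centralizer_iff]
  intro r hr
  rw [(hsa r hr).star_eq, and_self]
  refine commute_of_mem_vonNeumannGenerated ?_ hV
  rw [StarSubalgebra.mem_centralizer_iff]
  intro s hs
  rw [(hsa s hs).star_eq, and_self]
  exact hcomm s hs r hr

theorem mem_cyclicSubspace (R : Set (H →L[ℂ] H)) (v : H) : v ∈ cyclicSubspace R v :=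
  Submodule.le_topologicalClosure _ (Submodule.subset_span ⟨1, one_mem _, rfl⟩)

theorem cyclicProj_apply_of_mem {R : Set (H →L[ℂ] H)} {v y : H} (hy : y ∈ cyclicSubspace R v) :
    cyclicProj R v y = y :=
  Submodule.starProjection_eq_self_iff.2 hy

theorem cyclicProj_apply_mem (R : Set (H →L[ℂ] H)) (v y : H) :
    cyclicProj R v y ∈ cyclicSubspace R v :=
  Submodule.starProjection_apply_mem _ _

/-- Operators agreeing on the generators `V v` agree on the cyclic subspace. -/
theorem mul_cyclicProj_eq {R : Set (H →L[ℂ] H)} {v : H} {S T : H →L[ℂ] H}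
    (h : ∀ V ∈ vonNeumannGenerated R, S (V v) = T (V v)) :
    S * cyclicProj R v = T * cyclicProj R v := by
  ext y
  have hle : cyclicSubspace R v ≤ (S - T).ker := by
    refine Submodule.topologicalClosure_minimal _ (Submodule.span_le.2 ?_)
      (ContinuousLinearMap.isClosed_ker _)
    rintro _ ⟨V, hV, rfl⟩
    simpa [sub_eq_zero] using h V hV
  have := hle (cyclicProj_apply_mem R v y)
  simpa [sub_eq_zero] using this

/-- `L(Sᗮ) ⊕ R'' P` consists of the operators which commute with `P` and whose restriction to
`S` is that of an element of `R''`. -/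
theorem mem_concreteBeable_iff {R : Set (H →L[ℂ] H)} {v : H} {T : H →L[ℂ] H} :
    T ∈ concreteBeable R v ↔ Commute T (cyclicProj R v) ∧
      ∃ V ∈ vonNeumannGenerated R, V * cyclicProj R v = T * cyclicProj R v := by
  have hP := (isStarProjection_cyclicProj R v).isIdempotentElem.eq
  have h1 : cyclicProj R v * (1 - cyclicProj R v) = 0 := by rw [mul_sub, mul_one, hP, sub_self]
  have h2 : (1 - cyclicProj R v) * cyclicProj R v = 0 := by rw [sub_mul, one_mul, hP, sub_self]
  constructor
  · rintro ⟨X, V, hV, rfl⟩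
    have hc := cyclicProj_comm (v := v) hV
    generalize cyclicProj R v = P at hP h1 h2 hc ⊢
    have e : ((1 - P) * X * (1 - P) + V * P) * P = V * P := by
      rw [add_mul, mul_assoc _ (1 - P), h2, mul_zero, zero_add, mul_assoc, hP]
    refine ⟨?_, V, hV, e.symm⟩
    rw [commute_iff_eq, e, mul_add, mul_assoc (1 - P), ← mul_assoc P, h1, zero_mul, zero_add,
      ← mul_assoc, ← hc, mul_assoc, hP]
  · rintro ⟨hc, V, hV, hVT⟩
    refine ⟨T, V, hV, ?_⟩
    rw [hVT]
    have hc := hc.eq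
    generalize cyclicProj R v = P at hP h1 h2 hc ⊢
    have : P * T * P = T * P := by rw [← hc, mul_assoc, hP]
    rw [sub_mul, one_mul, mul_sub, mul_one, sub_mul, this, hc]
    abel

/-- The closed subspace `[R' v]`. -/
noncomputable def commutantCyclicSubspace (R : Set (H →L[ℂ] H)) (v : H) : Submodule ℂ H :=
  (Submodule.span ℂ {y | ∃ W ∈ (vonNeumannGenerated R).commutant, W v = y}).topologicalClosure

instance (R : Set (H →L[ℂ] H)) (v : H) : CompleteSpace (commutantCyclicSubspace R v) :=
  (Submodule.isClosed_topologicalClosure _).completeSpace_coe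

/-- The projection onto `[R' v]` is the support of `v` in `R''`. -/
theorem exists_support (R : Set (H →L[ℂ] H)) (v : H) :
    ∃ Z ∈ vonNeumannGenerated R, IsStarProjection Z ∧ Z v = v ∧
      ∀ V ∈ vonNeumannGenerated R, V v = 0 → V * Z = 0 := by
  set K := commutantCyclicSubspace R v
  have hZ : IsStarProjection K.starProjection := isStarProjection_starProjection
  refine ⟨K.starProjection, ?_, hZ, ?_, ?_⟩
  -- A projection lies in `R''` when its range is invariant under `R'`.
  · rw [VonNeumannAlgebra.IsStarProjection.mem_iff hZ]
    intro W hW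
    have hr : K.starProjection.range = K := by simp
    rw [hr, Module.End.mem_invtSubmodule]
    intro y hy
    refine map_mem_closure W.continuous hy fun z hz => ?_
    refine Submodule.span_induction (p := fun z _ => W z ∈
      Submodule.span ℂ {y | ∃ W ∈ (vonNeumannGenerated R).commutant, W v = y}) ?_ ?_ ?_ ?_ hz
    · rintro _ ⟨W', hW', rfl⟩
      exact Submodule.subset_span ⟨W * W', mul_mem hW hW', rfl⟩
    · simp
    · intro x y _ _ hx hy
      rw [map_add]
      exact add_mem hx hy
    · intro c x _ hx
      rw [map_smul]
      exact Submodule.smul_mem _ c hx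
  · exact Submodule.starProjection_eq_self_iff.2
      (Submodule.le_topologicalClosure _ (Submodule.subset_span ⟨1, one_mem _, rfl⟩))
  · intro V hV hv
    -- For `W ∈ R'`, `V W v = W V v = 0`.
    have hle : K ≤ V.ker := by
      refine Submodule.topologicalClosure_minimal _ (Submodule.span_le.2 ?_)
        (ContinuousLinearMap.isClosed_ker _)
      rintro _ ⟨W, hW, rfl⟩
      have := congr($(VonNeumannAlgebra.mem_commutant_iff.1 hW V hV) v)
      simpa [hv] using this
    ext y
    exact hle (Submodule.starProjection_apply_mem K y)

theorem isClosed_vonNeumannAlgebra (M : VonNeumannAlgebra H) : IsClosed (M : Set (H →L[ℂ] H)) := by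
  rw [← M.centralizer_centralizer]
  exact Set.isClosed_centralizer _

/-- The elements of `M` supported by `Z`. -/
def supportedSubalgebra (M : VonNeumannAlgebra H) (Z : H →L[ℂ] H) (hZ : IsSelfAdjoint Z)
    (hc : ∀ V ∈ M, Commute V Z) : NonUnitalStarSubalgebra ℂ (H →L[ℂ] H) where
  carrier := {V | V ∈ M ∧ V * Z = V}
  add_mem' := fun ⟨h1, h2⟩ ⟨h3, h4⟩ => ⟨add_mem h1 h3, by rw [add_mul, h2, h4]⟩
  zero_mem' := ⟨zero_mem M, zero_mul Z⟩
  mul_mem' := fun ⟨h1, _⟩ ⟨h3, h4⟩ => ⟨mul_mem h1 h3, by rw [mul_assoc, h4]⟩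
  smul_mem' := fun c V ⟨h1, h2⟩ =>
    ⟨M.toStarSubalgebra.smul_mem h1 c, by rw [smul_mul_assoc, h2]⟩
  star_mem' := fun {V} ⟨h1, h2⟩ => ⟨star_mem h1, by
    rw [(hc _ (star_mem h1)).eq]
    nth_rewrite 1 [← hZ.star_eq]
    rw [← star_mul, h2]⟩

/-- For an abelian von Neumann algebra, the reduced algebra `R'' P` is norm closed. -/
theorem isClosed_reduced {R : Set (H →L[ℂ] H)} {v : H}
    (hM : ∀ V ∈ vonNeumannGenerated R, ∀ W ∈ vonNeumannGenerated R, Commute V W) :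
    IsClosed {T : H →L[ℂ] H | ∃ V ∈ vonNeumannGenerated R, V * cyclicProj R v = T} := by
  obtain ⟨Z, hZM, hZ, hZv, hZker⟩ := exists_support R v
  -- Commutativity gives `Z V v = V Z v = V v`, so `Z` is the identity on `S`.
  have hZP : Z * cyclicProj R v = cyclicProj R v := by
    rw [← one_mul (cyclicProj R v), ← mul_assoc, mul_one]
    refine mul_cyclicProj_eq fun V hV => ?_
    have := congr($((hM Z hZM V hV).eq) v)
    simpa [hZv] using this
  have hP := isStarProjection_cyclicProj R v
  let N := supportedSubalgebra (vonNeumannGenerated R) Z hZ.isSelfAdjoint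
    fun V hV => hM V hV Z hZM
  have hN : IsClosed (N : Set (H →L[ℂ] H)) :=
    (isClosed_vonNeumannAlgebra (vonNeumannGenerated R)).inter
      (isClosed_eq (continuous_mul_const Z) continuous_id)
  -- An injective ⋆-homomorphism of C⋆-algebras is isometric. Cutting down to `R'' Z` secures
  -- injectivity: `V P = 0` forces `V v = 0`, hence `V = V Z = 0`. It loses nothing in the range,
  -- since `V Z P = V P`.
  let f : N →⋆ₙₐ[ℂ] (H →L[ℂ] H) :=
    { toFun := fun V => V.1 * cyclicProj R v
      map_smul' := fun c V => smul_mul_assoc c V.1 _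
      map_zero' := zero_mul _
      map_add' := fun V W => add_mul V.1 W.1 _
      map_mul' := fun V W => by
        change V.1 * W.1 * _ = V.1 * _ * (W.1 * _)
        rw [mul_assoc V.1 _ (W.1 * _), ← mul_assoc _ W.1, ← cyclicProj_comm W.2.1, mul_assoc W.1,
          hP.isIdempotentElem.eq, mul_assoc]
      map_star' := fun V => by
        change star V.1 * _ = star (V.1 * _)
        rw [star_mul, hP.isSelfAdjoint.star_eq, cyclicProj_comm (star_mem V.2.1)] }
  have hf : Function.Injective f := by
    rw [injective_iff_map_eq_zero]
    intro V hV
    have h0 : V.1 v = 0 := by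
      have : (V.1 * cyclicProj R v) v = 0 := congr($hV v)
      rwa [mul_apply_eq_comp, cyclicProj_apply_of_mem (mem_cyclicSubspace R v)] at this
    exact Subtype.ext (V.2.2.symm.trans (hZker V.1 V.2.1 h0))
  have hiso : Isometry f := NonUnitalStarAlgHom.isometry f hf
  have : CompleteSpace N := hN.completeSpace_coe
  have hrange : {T : H →L[ℂ] H | ∃ V ∈ vonNeumannGenerated R, V * cyclicProj R v = T} =
      Set.range f := by
    ext T
    constructor
    · rintro ⟨V, hV, rfl⟩
      refine ⟨⟨V * Z, mul_mem hV hZM, by rw [mul_assoc, hZ.isIdempotentElem.eq]⟩, ?_⟩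
      change V * Z * _ = _
      rw [mul_assoc, hZP]
    · rintro ⟨V, rfl⟩
      exact ⟨V.1, V.2.1, rfl⟩
  rw [hrange]
  exact hiso.isClosedEmbedding.isClosed_range

theorem isClosed_concreteBeable {R : Set (H →L[ℂ] H)} {v : H}
    (hM : ∀ V ∈ vonNeumannGenerated R, ∀ W ∈ vonNeumannGenerated R, Commute V W) :
    IsClosed (concreteBeable R v : Set (H →L[ℂ] H)) := by
  have : (concreteBeable R v : Set (H →L[ℂ] H)) = {T | T * cyclicProj R v = cyclicProj R v * T} ∩
      (fun T => T * cyclicProj R v) ⁻¹'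
        {T | ∃ V ∈ vonNeumannGenerated R, V * cyclicProj R v = T} := by
    ext T
    exact mem_concreteBeable_iff
  rw [this]
  exact (isClosed_eq (continuous_mul_const _) (continuous_const_mul _)).inter
    ((isClosed_reduced hM).preimage (continuous_mul_const _))

theorem vonNeumannGenerated_le_concreteBeable {R : Set (H →L[ℂ] H)} {v : H} {V : H →L[ℂ] H}
    (hV : V ∈ vonNeumannGenerated R) : V ∈ concreteBeable R v :=
  mem_concreteBeable_iff.2 ⟨cyclicProj_comm hV, V, hV, rfl⟩

/-- An element of the commutant having `v` as a common eigenvector with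
its adjoint belongs to the algebra. -/
theorem mem_concreteBeable_of_eigenvector {R : Set (H →L[ℂ] H)} {v : H} {T : H →L[ℂ] H} {c d : ℂ}
    (hT : T ∈ StarSubalgebra.centralizer ℂ R) (hv : T v = c • v) (hv' : star T v = d • v) :
    T ∈ concreteBeable R v := by
  have key : ∀ {T : H →L[ℂ] H} {c : ℂ}, T ∈ StarSubalgebra.centralizer ℂ R → T v = c • v →
      T * cyclicProj R v = algebraMap ℂ _ c * cyclicProj R v := by
    intro T c hT hv
    refine mul_cyclicProj_eq fun V hV => ?_
    have := congr($((commute_of_mem_vonNeumannGenerated hT hV).eq) v)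
    simpa [hv, Algebra.algebraMap_eq_smul_one] using this
  have h1 := key hT hv
  -- The adjoint of the relation for `star T` says that `P T` is also a multiple of `P`; thus `P T
  -- P` equals both `T P` and `P T`.
  have h2 := congr(star $(key (star_mem hT) hv'))
  have hP := isStarProjection_cyclicProj R v
  have hPi := hP.isIdempotentElem.eq
  simp only [star_mul, star_star, hP.isSelfAdjoint.star_eq] at h2
  rw [← algebraMap_star_comm, ← Algebra.commutes] at h2
  refine mem_concreteBeable_iff.2 ⟨?_, _,
    (vonNeumannGenerated R).toStarSubalgebra.algebraMap_mem c, h1.symm⟩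
  have h3 : cyclicProj R v * T * cyclicProj R v = T * cyclicProj R v := by
    rw [mul_assoc, h1, ← mul_assoc, ← Algebra.commutes, mul_assoc, hPi]
  have h4 : cyclicProj R v * T * cyclicProj R v = cyclicProj R v * T := by
    rw [h2, mul_assoc, hPi]
  rw [commute_iff_eq, ← h3, h4]

end Concrete

open MeasureTheory

/-! ### Restriction to an invariant subspace -/

section Compression

variable {H : Type*} [NormedAddCommGroup H] [InnerProductSpace ℂ H] [CompleteSpace H]

/-- Restriction to a closed subspace invariant under a ⋆-algebra of operators. -/
noncomputable def restrictInvariant (S : Submodule ℂ H) [CompleteSpace S]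
    (C : StarSubalgebra ℂ (H →L[ℂ] H)) (hC : ∀ T ∈ C, ∀ y ∈ S, T y ∈ S) :
    C →⋆ₐ[ℂ] (S →L[ℂ] S) where
  toFun T := S.orthogonalProjectionOnto ∘L T.1 ∘L S.subtypeL
  map_one' := by
    ext y
    simp
  map_mul' T T' := by
    ext y
    have h1 : ((S.orthogonalProjectionOnto (T'.1 y) : S) : H) = T'.1 y :=
      Submodule.starProjection_eq_self_iff.2 (hC T'.1 T'.2 y y.2)
    simp [h1]
  map_zero' := by
    ext y
    simp
  map_add' T T' := by
    ext y
    simp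
  commutes' c := by
    ext y
    simp [Algebra.algebraMap_eq_smul_one]
  map_star' T := by
    rw [ContinuousLinearMap.star_eq_adjoint, ContinuousLinearMap.adjoint_comp,
      ContinuousLinearMap.adjoint_comp, Submodule.adjoint_subtypeL,
      Submodule.adjoint_orthogonalProjectionOnto]
    rfl

theorem coe_restrictInvariant_apply (S : Submodule ℂ H) [CompleteSpace S]
    (C : StarSubalgebra ℂ (H →L[ℂ] H)) (hC : ∀ T ∈ C, ∀ y ∈ S, T y ∈ S) (T : C) (y : S) :
    (restrictInvariant S C hC T y : H) = T.1 y :=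
  Submodule.starProjection_eq_self_iff.2 (hC T.1 T.2 y y.2)

end Compression

/-! ### States of commutative C⋆-algebras as integrals of characters -/

section Commutative

/-- A state of a commutative C⋆-algebra is a mixture of characters. -/
theorem IsState.exists_measure_characterSpace {N : Type*} [CommCStarAlgebra N]
    {φ : N →ₗ[ℂ] ℂ} (hφ : IsState φ)
    [MeasurableSpace (WeakDual.characterSpace ℂ N)] [BorelSpace (WeakDual.characterSpace ℂ N)] :
    ∃ μ : Measure (WeakDual.characterSpace ℂ N), IsProbabilityMeasure μ ∧
      ∀ a : N, φ a = ∫ χ : WeakDual.characterSpace ℂ N, χ a ∂μ := by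
  let X := WeakDual.characterSpace ℂ N
  let e := (gelfandStarTransform N).symm
  let cx : C(X, ℝ) → C(X, ℂ) := fun g => ⟨fun χ => (g χ : ℂ), by fun_prop⟩
  let L : CompactlySupportedContinuousMap X ℝ →ₗ[ℝ] ℝ :=
    { toFun := fun g => (φ (e (cx g))).re
      map_add' := fun g h => by
        have : cx (g + h : CompactlySupportedContinuousMap X ℝ) = cx g + cx h := by
          ext χ
          simp [cx]
        rw [this, map_add, map_add, Complex.add_re]
      map_smul' := fun c g => by
        have : cx (c • g : CompactlySupportedContinuousMap X ℝ) = (c : ℂ) • cx g := by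
          ext χ
          simp [cx]
        rw [this, map_smul, map_smul]
        simp }
  have hL : ∀ g : CompactlySupportedContinuousMap X ℝ, 0 ≤ g → 0 ≤ L g := by
    intro g hg
    -- Positivity of a state is known only on elements `star h * h`, hence the square root.
    let h : C(X, ℂ) := ⟨fun χ => (Real.sqrt (g χ) : ℂ), by
      have := g.continuous
      fun_prop⟩
    have : cx g = star h * h := by
      ext χ
      have : Real.sqrt (g χ) * Real.sqrt (g χ) = g χ := Real.mul_self_sqrt (hg χ)
      simp only [cx, h, ContinuousMap.mul_apply, ContinuousMap.star_apply, ContinuousMap.coe_mk,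
        Complex.star_def, Complex.conj_ofReal, ← Complex.ofReal_mul, this]
    change 0 ≤ (φ (e (cx g))).re
    rw [this, map_mul, map_star]
    exact (Complex.nonneg_iff.1 (hφ.nonneg _)).1
  let Λ : CompactlySupportedContinuousMap X ℝ →ₚ[ℝ] ℝ := PositiveLinearMap.mk₀ L hL
  let toCc : C(X, ℝ) → CompactlySupportedContinuousMap X ℝ :=
    fun g => ⟨g, HasCompactSupport.of_compactSpace _⟩
  let μ := RealRMK.rieszMeasure Λ
  have hfin : IsFiniteMeasure μ := ⟨isCompact_univ.measure_lt_top⟩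
  have hreal : ∀ b : N, IsSelfAdjoint b → φ b = ∫ χ : X, χ b ∂μ := by
    intro b hb
    let g : C(X, ℝ) := ⟨fun χ => (χ b).re, Complex.continuous_re.comp
      ((WeakDual.gelfandTransform ℂ N b).continuous)⟩
    have hχ : ∀ χ : X, χ b = ((χ b).re : ℂ) := fun χ => by
      have : star (χ b) = χ b := by rw [← map_star, hb.star_eq]
      exact (Complex.conj_eq_iff_re.1 this).symm
    have hg : e (cx (toCc g)) = b := by
      rw [← (gelfandStarTransform N).symm_apply_apply b]
      congr 1
      ext χ
      exact (hχ χ).symm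
    have h1 : ∫ χ : X, g χ ∂μ = (φ b).re := by
      have h2 : (φ (e (cx (toCc g)))).re = (φ b).re := by rw [hg]
      exact (RealRMK.integral_rieszMeasure Λ (toCc g)).trans h2
    calc φ b = ((φ b).re : ℂ) := Complex.ext rfl (by simp [hφ.im_eq_zero hb])
      _ = ∫ χ : X, ((χ b).re : ℂ) ∂μ := by
        rw [← h1]
        exact integral_ofReal.symm
      _ = ∫ χ : X, χ b ∂μ := integral_congr_ae (.of_forall fun χ => (hχ χ).symm)
  have hint : ∀ b : N, Integrable (fun χ : X => χ b) μ := fun b =>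
    (WeakDual.gelfandTransform ℂ N b).continuous.integrable_of_hasCompactSupport
      (HasCompactSupport.of_compactSpace _)
  refine ⟨μ, ⟨?_⟩, fun a => ?_⟩
  · have h1 := hreal 1 (.one N)
    have h3 : ∫ χ : X, χ (1 : N) ∂μ = ∫ _ : X, (1 : ℂ) ∂μ :=
      integral_congr_ae (.of_forall fun χ => _root_.map_one χ)
    rw [h3, hφ.map_one, integral_const, Complex.real_smul, mul_one] at h1
    have h2 : μ.real Set.univ = 1 := by exact_mod_cast h1.symm
    rwa [measureReal_def, ENNReal.toReal_eq_one_iff] at h2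
  · have ha := realPart_add_I_smul_imaginaryPart a
    rw [← ha, map_add, map_smul, hreal _ (realPart a).2, hreal _ (imaginaryPart a).2,
      smul_eq_mul, ← integral_const_mul, ← integral_add (hint _) ((hint _).const_mul _)]
    refine integral_congr_ae (.of_forall fun χ => ?_)
    simp only [map_add, map_smul, smul_eq_mul]

end Commutative

/-! ### Beability through a commutative quotient -/

section Beable

variable {A : Type*} [CStarAlgebra A] [PartialOrder A]

/-- A subalgebra is beable for `ρ` as soon as `ρ` factors through a continuous ⋆-homomorphism
with commutative range into a C⋆-algebra carrying a state. -/
theorem isBeable_of_starAlgHom {B : StarSubalgebra ℂ A} {ρ : A →ₚ[ℂ] ℂ} {E : Type*}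
    [CStarAlgebra E] (f : B →⋆ₐ[ℂ] E) (hf : Continuous f)
    (hcomm : ∀ a b : B, Commute (f a) (f b)) {φ : E →ₗ[ℂ] ℂ} (hφ : IsState φ)
    (hρ : ∀ b : B, ρ b = φ (f b)) : IsBeable B ρ := by
  -- The range need not be closed; its closure is a commutative C⋆-algebra, to which Gelfand theory
  -- applies.
  let N := f.range.topologicalClosure
  have hN : IsClosed (N : Set E) := StarSubalgebra.isClosed_topologicalClosure _
  let : CommRing N := f.range.commRingTopologicalClosure (by
    rintro ⟨_, a, rfl⟩ ⟨_, b, rfl⟩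
    exact Subtype.ext (hcomm a b))
  let : CommCStarAlgebra N :=
    { StarSubalgebra.cstarAlgebra N with mul_comm := mul_comm }
  let fN : B →⋆ₐ[ℂ] N := f.codRestrict N fun b =>
    StarSubalgebra.le_topologicalClosure _ ⟨b, rfl⟩
  have hfN : Continuous fN := hf.subtype_mk _
  let φN : N →ₗ[ℂ] ℂ := φ ∘ₗ N.subtype.toAlgHom.toLinearMap
  have hφN : IsState φN := ⟨hφ.map_one, fun b => hφ.nonneg b.1⟩
  let : MeasurableSpace (WeakDual.characterSpace ℂ N) := borel _
  have : BorelSpace (WeakDual.characterSpace ℂ N) := ⟨rfl⟩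
  obtain ⟨μ, hμ, hint⟩ := hφN.exists_measure_characterSpace
  -- The measure sought is the image under `χ ↦ χ ∘ f` of the one on the character space.
  let pull : WeakDual.characterSpace ℂ N → DispersionFreeState B := fun χ =>
    ⟨(⟨(χ.1 : N →L[ℂ] ℂ).toLinearMap ∘ₗ fN.toAlgHom.toLinearMap,
        (map_continuous χ).comp hfN⟩ : B →L[ℂ] ℂ), by
      refine ⟨⟨?_, fun b => ?_⟩, fun X Y => ?_⟩
      · change χ (fN 1) = 1
        rw [map_one, map_one]
      · change 0 ≤ χ (fN (star b * b))
        rw [map_mul, map_mul, map_star, map_star]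
        exact star_mul_self_nonneg _
      · change χ (fN (X * Y)) = χ (fN X) * χ (fN Y)
        rw [map_mul, map_mul]⟩
  have hpull : ∀ χ (b : B), (pull χ).1 b = χ (fN b) := fun _ _ => rfl
  have hcont : Continuous pull := by
    refine Continuous.subtype_mk (WeakDual.continuous_of_continuous_eval fun b => ?_) _
    exact (WeakDual.gelfandTransform ℂ N (fN b)).continuous
  have hmeas : Measurable pull := hcont.measurable
  have heval : ∀ b : B, Continuous fun ω : DispersionFreeState B => ω.1 b := fun b =>
    (WeakDual.eval_continuous b).comp continuous_subtype_val
  refine ⟨μ.map pull, Measure.isProbabilityMeasure_map hmeas.aemeasurable, fun b => ⟨?_, ?_⟩⟩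
  · rw [integrable_map_measure (heval b).aestronglyMeasurable hmeas.aemeasurable]
    exact (WeakDual.gelfandTransform ℂ N (fN b)).continuous.integrable_of_hasCompactSupport
      (HasCompactSupport.of_compactSpace _)
  · rw [integral_map hmeas.aemeasurable (heval b).aestronglyMeasurable, hρ]
    exact hint (fN b)

end Beable

/-! ### Assembly in the GNS representation -/

section Main

variable {A : Type*} [CStarAlgebra A] [PartialOrder A] [StarOrderedRing A]

/-- The possibly noncommutative block `L(Sᗮ)` is invisible to `ρ`, whose GNS vector lies in `S`;
only the action on `S`, through the commuting elements of `π(R)''`, matters. -/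
theorem isBeable_beableAlgebra {R : Set A} {ρ : A →ₚ[ℂ] ℂ} (hone : ρ 1 = 1)
    (hM : ∀ V ∈ vonNeumannGenerated (ρ.gnsStarAlgHom '' R),
      ∀ W ∈ vonNeumannGenerated (ρ.gnsStarAlgHom '' R), Commute V W) :
    IsBeable (beableAlgebra R ρ) ρ := by
  set C := concreteBeable (ρ.gnsStarAlgHom '' R) (gnsVector ρ) with hC
  let S := cyclicSubspace (ρ.gnsStarAlgHom '' R) (gnsVector ρ)
  have hagree : ∀ T ∈ C, ∃ V ∈ vonNeumannGenerated (ρ.gnsStarAlgHom '' R),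
      ∀ y ∈ S, T y = V y := by
    intro T hT
    obtain ⟨-, V, hV, h⟩ := mem_concreteBeable_iff.1 hT
    refine ⟨V, hV, fun y hy => ?_⟩
    have := congr($h y)
    rw [mul_apply_eq_comp, mul_apply_eq_comp, cyclicProj_apply_of_mem hy] at this
    exact this.symm
  have hinv : ∀ T ∈ C, ∀ y ∈ S, T y ∈ S := by
    intro T hT y hy
    obtain ⟨V, hV, h⟩ := hagree T hT
    rw [h y hy]
    exact map_mem_cyclicSubspace hV hy
  let π : beableAlgebra R ρ →⋆ₐ[ℂ] C :=
    (ρ.gnsStarAlgHom.comp (beableAlgebra R ρ).subtype).codRestrict C fun b => b.2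
  let f : beableAlgebra R ρ →⋆ₐ[ℂ] (S →L[ℂ] S) := (restrictInvariant S C hinv).comp π
  have hfapply : ∀ b y, (f b y : ρ.GNS) = ρ.gnsStarAlgHom b y := fun b y =>
    coe_restrictInvariant_apply S C hinv (π b) y
  have hf : Continuous f := by
    have hπ : Continuous fun b : beableAlgebra R ρ => ρ.gnsStarAlgHom (b : A) :=
      (map_continuous ρ.gnsStarAlgHom).comp continuous_subtype_val
    exact continuous_const.clm_comp (hπ.clm_comp continuous_const)
  let x : S := ⟨gnsVector ρ, mem_cyclicSubspace _ _⟩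
  let φ : (S →L[ℂ] S) →ₗ[ℂ] ℂ :=
    { toFun := fun T => inner ℂ x (T x)
      map_add' := fun T T' => inner_add_right _ _ _
      map_smul' := fun c T => inner_smul_right _ _ _ }
  have hx : inner ℂ x x = (1 : ℂ) := by
    have := inner_gnsVector ρ 1
    rwa [map_one, hone] at this
  have hφ : IsState φ := by
    refine ⟨hx, fun T => ?_⟩
    change 0 ≤ inner ℂ x ((star T * T) x)
    rw [mul_apply_eq_comp, ContinuousLinearMap.star_eq_adjoint,
      ContinuousLinearMap.adjoint_inner_right]
    rw [inner_self_eq_norm_sq_to_K, ← RCLike.ofReal_pow]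
    exact RCLike.ofReal_nonneg.2 (sq_nonneg ‖T x‖)
  refine isBeable_of_starAlgHom (E := S →L[ℂ] S) (φ := φ) f hf (fun a b => ?_) hφ fun b => ?_
  · obtain ⟨V, hV, hVa⟩ := hagree _ a.2
    obtain ⟨W, hW, hWb⟩ := hagree _ b.2
    ext y
    have ha : ∀ z : S, (f a z : ρ.GNS) = V z := fun z => (hfapply a z).trans (hVa z z.2)
    have hb : ∀ z : S, (f b z : ρ.GNS) = W z := fun z => (hfapply b z).trans (hWb z z.2)
    rw [mul_apply_eq_comp, mul_apply_eq_comp, ha, hb, hb, ha]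
    exact congr($((hM V hV W hW).eq) (y : ρ.GNS))
  · change ρ b = inner ℂ (gnsVector ρ) (f b x : ρ.GNS)
    rw [hfapply, inner_gnsVector]

end Main

end BeableAlgebra

open BeableAlgebra in
theorem mainTheorem10 {A : Type*} [CStarAlgebra A] [PartialOrder A] [StarOrderedRing A]
    (ρ : A →ₚ[ℂ] ℂ) (hρ : BeableAlgebra.IsPureState ρ.toLinearMap)
    (R : Set A) (hsa : ∀ a ∈ R, IsSelfAdjoint a) (hcomm : ∀ a ∈ R, ∀ b ∈ R, Commute a b) :
    BeableAlgebra.IsRBeable R (BeableAlgebra.beableAlgebra R ρ) ρ ∧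
      ∀ U ∈ unitary A, U ∈ Set.centralizer R → BeableAlgebra.Fixes U ρ →
        U ∈ BeableAlgebra.beableAlgebra R ρ := by
  have hM : ∀ V ∈ vonNeumannGenerated (ρ.gnsStarAlgHom '' R),
      ∀ W ∈ vonNeumannGenerated (ρ.gnsStarAlgHom '' R), Commute V W := by
    intro V hV W hW
    refine vonNeumannGenerated_commute ?_ ?_ hV hW
    · rintro _ ⟨a, ha, rfl⟩
      exact (hsa a ha).map ρ.gnsStarAlgHom
    · rintro _ ⟨a, ha, rfl⟩ _ ⟨b, hb, rfl⟩
      exact (hcomm a ha b hb).map ρ.gnsStarAlgHom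
  have hmem : ∀ U ∈ unitary A, U ∈ Set.centralizer R → Fixes U ρ → U ∈ beableAlgebra R ρ := by
    intro U hU hUR hfix
    have hv := gnsStarAlgHom_apply_gnsVector ρ hρ hU hfix
    -- The eigenvector property is needed for the adjoint too; apply the fixing hypothesis for `U`
    -- to `U a U⋆`.
    have hfix' : Fixes (star U) ρ := fun a => by
      rw [← hfix (star (star U) * a * star U)]
      congr 1
      simp only [star_star, mul_assoc, Unitary.star_mul_self_of_mem hU, mul_one]
      rw [← mul_assoc, Unitary.star_mul_self_of_mem hU, one_mul]
    have hv' := gnsStarAlgHom_apply_gnsVector ρ hρ (Unitary.star_mem hU) hfix'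
    rw [map_star] at hv'
    refine mem_concreteBeable_of_eigenvector ?_ hv hv'
    rw [StarSubalgebra.mem_centralizer_iff]
    rintro _ ⟨r, hr, rfl⟩
    rw [← map_star, (hsa r hr).star_eq, and_self]
    exact (show Commute r U from hUR r hr).map ρ.gnsStarAlgHom
  refine ⟨⟨?_, isBeable_beableAlgebra hρ.1.map_one hM, ?_, ?_⟩, hmem⟩
  · exact (isClosed_concreteBeable hM).preimage (map_continuous ρ.gnsStarAlgHom)
  · intro r hr
    exact vonNeumannGenerated_le_concreteBeable (subset_vonNeumannGenerated _ ⟨r, hr, rfl⟩)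
  · intro U hU hUR hfix
    have hUB := hmem U hU hUR hfix
    ext b
    constructor
    · rintro ⟨c, hc, rfl⟩
      exact mul_mem (mul_mem hUB hc) (star_mem hUB)
    · intro hb
      refine ⟨star U * b * U, mul_mem (mul_mem (star_mem hUB) hb) hUB, ?_⟩
      change U * (star U * b * U) * star U = b
      simp only [mul_assoc, Unitary.mul_star_self_of_mem hU, mul_one]
      rw [← mul_assoc, Unitary.mul_star_self_of_mem hU, one_mul]
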